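/- Let $G=(V,E)$ be a finite connected undirected graph without loops, multiple edges being allowed, with $n=\#V\ge 2$ vertices. A divisor is an element $D\in\mathbb{Z}V$; two divisors are equivalent, $D\sim D'$, if $D-D'$ lies in the image of the Laplacian of $G$; and $|D|$ is the set of all divisors $D'\ge 0$ with $D'\sim D$. A divisor $D$ is unstable if $D_v\ge\deg(v)$ for some $v\in V$, and stable otherwise; $D$ is alive if $|D|$ contains no stable divisor, and minimally alive if it is alive and $D-1_v$ is not alive for every $v\in V$. A cut of a set $S\subseteq V$ inducing a connected subgraph is a decomposition $S=A\sqcup B$ into two nonempty sets inducing connected subgraphs. A generating sequence of a partition $\Pi$ of $V$ into $k+1$ connected components is a sequence of cuts $C_1,\dots,C_k$ with components $A_i,B_i$, where $C_1$ is a cut of $V$ and, for $i\ge 2$, $C_i$ is a cut of $A_{i-1}$ or of $B_{i-1}$, such that applying the cuts one after the other to the partition $\{V\}$ produces $\Pi$. A $\Pi$-boundary divisor is a divisor $D$ for which there are a generating sequence of $\Pi$ and a choice of $X_i\in\{A_i,B_i\}$ with $$D_v=\sum_{i=1}^{k}\deg_{A_iB_i}(v)\,\chi_{X_i}(v)\qquad\text{for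 all } v\in V,$$ where $\deg_{AB}(v)$ is the number of edges incident to $v$ that join $A$ and $B$, and $\chi_X$ is the characteristic function of $X$. There is exactly one partition $\Pi$ of $V$ into $n$ connected components (the partition into singletons), and, up to equivalence, the $\Pi$-boundary divisors are exactly the minimally alive divisors: a divisor $D$ is equivalent to a $\Pi$-boundary divisor if and only if $D$ is minimally alive. The same equivalence holds if, in a generating sequence, $C_i$ is allowed to be a cut of any component of the partition produced by $C_1,\dots,C_{i-1}$. -/

import Mathlib

/-!
Chip firing on a finite multigraph `G : Graph α β`. Divisors and firing scripts are functions
`V(G) → ℤ`. Loops are excluded in the theorem by `[G.Loopless]`, connectedness is that of the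
underlying simple graph `G.toSimpleGraph`.
-/

open scoped Graph

namespace ChipFiring

variable {α β : Type*} (G : Graph α β)

/-- The degree of a vertex: the number of edges incident to it. -/
noncomputable def deg (v : V(G)) : ℕ := {e : β | G.Inc e v}.ncard

/-- The number of edges connecting two vertices. -/
noncomputable def mult (v w : V(G)) : ℕ := {e : β | G.IsLink e v w}.ncard

open Classical in
/-- The Laplacian of `G`. -/
noncomputable def laplacian : Matrix V(G) V(G) ℤ :=
  Matrix.of fun v w => if v = w then (deg G v : ℤ) else -(mult G v w : ℤ)

/-- `D₀ ∼ D₁`: the two divisors differ by an element of the image of the Laplacian, that is, they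
agree in the class group `Cl(G)`. -/
def Equivalent [Fintype V(G)] (D₀ D₁ : V(G) → ℤ) : Prop :=
  ∃ σ : V(G) → ℤ, D₀ - (laplacian G).mulVec σ = D₁

/-- The linear system `|D|`: the effective divisors equivalent to `D`. -/
def linearSystem [Fintype V(G)] (D : V(G) → ℤ) : Set (V(G) → ℤ) :=
  {D' | Equivalent G D D' ∧ 0 ≤ D'}

/-- A divisor is unstable if some vertex has at least as many chips as its degree. -/
def Unstable (D : V(G) → ℤ) : Prop := ∃ v, (deg G v : ℤ) ≤ D v

/-- A divisor `D` is alive if `|D|` contains no stable divisor. -/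
def Alive [Fintype V(G)] (D : V(G) → ℤ) : Prop := ¬ ∃ D' ∈ linearSystem G D, ¬ Unstable G D'

open Classical in
/-- `D` is minimally alive if it is alive and no `D - 1_v` is alive. -/
def MinimallyAlive [Fintype V(G)] (D : V(G) → ℤ) : Prop :=
  Alive G D ∧ ∀ v : V(G), ¬ Alive G (D - Pi.single v 1)

/-- A (nonempty) set of vertices that induces a connected subgraph of `G`. -/
def ConnectedSet (S : Set V(G)) : Prop := (G.toSimpleGraph.induce S).Connected

/-- The set `𝒫_k` of partitions of the vertex set into `k` connected components. -/
def connectedPartitions (k : ℕ) : Set (Set (Set V(G))) :=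
  {P | Setoid.IsPartition P ∧ P.ncard = k ∧ ∀ S ∈ P, ConnectedSet G S}

/-- A cut of the subgraph induced on `S`, given by the two connected components `A` and `B` into
which it separates `S`. -/
structure IsCut (S A B : Set V(G)) : Prop where
  union_eq : A ∪ B = S
  disjoint : Disjoint A B
  connected_left : ConnectedSet G A
  connected_right : ConnectedSet G B

/-- The crossing degree of `v` with respect to `A` and `B`: the number of edges incident to `v`
that run between `A` and `B`. -/
noncomputable def crossDeg (A B : Set V(G)) (v : V(G)) : ℕ :=
  {e : β | G.Inc e v ∧ ∃ a ∈ A, ∃ b ∈ B, G.IsLink e a b}.ncard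

/-- The partition obtained from `{V}` by applying the first `i` of a sequence of cuts, the `j`-th
of which replaces the block `A j ∪ B j` by the two blocks `A j` and `B j`. -/
def partitionAfter (A B : ℕ → Set V(G)) : ℕ → Set (Set V(G))
  | 0 => {Set.univ}
  | i + 1 => insert (A i) (insert (B i) (partitionAfter A B i \ {A i ∪ B i}))

/-- The cuts `(A i, B i)`, `i < k`, form a generating sequence of `P`: the first one is a cut of
`G`, every later one is a cut of one of the two connected components produced by the cut just
before it, and applied sequentially they produce `P`. -/
structure IsGeneratingSequence (P : Set (Set V(G))) (k : ℕ) (A B : ℕ → Set V(G)) : Prop where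
  first : 0 < k → IsCut G Set.univ (A 0) (B 0)
  next : ∀ i, i + 1 < k →
    IsCut G (A i) (A (i + 1)) (B (i + 1)) ∨ IsCut G (B i) (A (i + 1)) (B (i + 1))
  produces : partitionAfter G A B k = P

/-- The variant in which every cut may be applied to any of the connected components that the
preceding cuts have produced so far. -/
structure IsFreeGeneratingSequence (P : Set (Set V(G))) (k : ℕ) (A B : ℕ → Set V(G)) : Prop where
  cut : ∀ i < k, ∃ S ∈ partitionAfter G A B i, IsCut G S (A i) (B i)
  produces : partitionAfter G A B k = P

open Classical in
/-- `D v = ∑ i < k, deg_{A i, B i}(v) χ_{X i}(v)` for some choice of `X i ∈ {A i, B i}`. -/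
def ArisesFrom (k : ℕ) (A B : ℕ → Set V(G)) (D : V(G) → ℤ) : Prop :=
  ∃ X : ℕ → Set V(G), (∀ i < k, X i = A i ∨ X i = B i) ∧
    ∀ v, D v = ∑ i ∈ Finset.range k, if v ∈ X i then (crossDeg G (A i) (B i) v : ℤ) else 0

/-- `D` is a boundary divisor with respect to the partition `P`. -/
def IsBoundaryDivisor (P : Set (Set V(G))) (D : V(G) → ℤ) : Prop :=
  ∃ (k : ℕ) (A B : ℕ → Set V(G)), IsGeneratingSequence G P k A B ∧ ArisesFrom G k A B D

/-- Boundary divisors with respect to `P` for the wider class of generating sequences. -/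
def IsFreeBoundaryDivisor (P : Set (Set V(G))) (D : V(G) → ℤ) : Prop :=
  ∃ (k : ℕ) (A B : ℕ → Set V(G)), IsFreeGeneratingSequence G P k A B ∧ ArisesFrom G k A B D

end ChipFiring

open scoped Graph

namespace ChipFiring

variable {α β : Type*} (G : Graph α β)

/-! ### Edge counts through multiplicities. -/

section Multiplicities

/-! An injective `t` directs every edge towards its end with smaller `t`; `orderDivisor G t` is the
in-degree divisor of this acyclic orientation. Both sides of the equivalence describe exactly the
classes of these divisors.

Such a divisor is alive, as is anything above it (`alive_of_orderDivisor_le`). Firing sinks makes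
any chosen vertex the only sink; taking a chip from it then leaves a stable divisor, whence
minimality. Conversely, an alive effective divisor can be fired legally for ever. Connectedness
forces every vertex to fire, and each then holds at least the chips received since its last firing,
so the divisor reached dominates the one given by the last firing times
(`exists_equivalent_orderDivisor_le`). Minimality gives equality.

A cut with choice `X i` directs its crossing edges towards `X i`. Level sets of `t` record the
blocks, edges inside a block being still undirected; singleton blocks mean that `t` is injective
(`IsFreeGeneratingSequence.exists_eq_orderDivisor`). Conversely, if the sink is unique, sources can
be peeled off one by one with connected remainder (`isBoundaryDivisor_orderDivisor`). -/

theorem mult_comm (v w : V(G)) : mult G v w = mult G w v := by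
  simp only [mult, G.isLink_comm]

theorem mult_self [G.Loopless] (v : V(G)) : mult G v v = 0 := by
  have : {e : β | G.IsLink e v v} = ∅ := by
    ext e
    simp
  rw [mult, this, Set.ncard_empty]

theorem finite_setOf_of_mem_edgeSet [Finite E(G)] (p : β → Prop) (hp : ∀ e, p e → e ∈ E(G)) :
    {e | p e}.Finite :=
  (Set.toFinite E(G)).subset hp

theorem mult_pos_of_adj [Finite E(G)] {v w : V(G)} (h : G.toSimpleGraph.Adj v w) :
    0 < mult G v w := by
  obtain ⟨e, he⟩ : G.Adj v w := by
    have := h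
    simp only [Graph.toSimpleGraph_adj] at this
    exact this.2
  exact (Set.ncard_pos (finite_setOf_of_mem_edgeSet G _ fun e he => he.edge_mem)).2 ⟨e, he⟩

theorem adj_of_mult_pos [G.Loopless] {v w : V(G)} (h : 0 < mult G v w) :
    G.toSimpleGraph.Adj v w := by
  obtain ⟨e, he⟩ := Set.nonempty_of_ncard_ne_zero h.ne'
  exact (Graph.toSimpleGraph_adj_iff v w).2 ⟨e, he⟩

open Classical in
/-- The edges from `v` to a set of vertices are counted by the multiplicities. -/
theorem ncard_edges_to [Fintype V(G)] [Finite E(G)] (v : V(G)) (T : Set V(G)) :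
    {e : β | ∃ w ∈ T, G.IsLink e v w}.ncard = ∑ w, if w ∈ T then mult G v w else 0 := by
  have key : ∀ s : Finset V(G),
      {e : β | ∃ w ∈ s, G.IsLink e v w}.ncard = ∑ w ∈ s, mult G v w := by
    intro s
    induction s using Finset.induction_on with
    | empty => simp
    | insert a s ha ih =>
      have hdisj : Disjoint {e : β | G.IsLink e v a} {e : β | ∃ w ∈ s, G.IsLink e v w} := by
        rw [Set.disjoint_left]
        rintro e he ⟨w, hw, he'⟩
        exact ha ((Subtype.ext (he.right_unique he') : a = w) ▸ hw)
      rw [Finset.sum_insert ha, ← ih, mult, ← Set.ncard_union_eq hdisj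
        (finite_setOf_of_mem_edgeSet G _ fun e he => he.edge_mem)
        (finite_setOf_of_mem_edgeSet G _ fun e ⟨w, _, he⟩ => he.edge_mem)]
      congr 1
      ext e
      simp
  rw [← Finset.sum_filter, ← key]
  simp

theorem deg_eq_sum_mult [Fintype V(G)] [Finite E(G)] (v : V(G)) :
    deg G v = ∑ w, mult G v w := by
  have h := ncard_edges_to G v Set.univ
  simp only [Set.mem_univ, true_and, if_true] at h
  rw [← h, deg]
  congr 1
  ext e
  constructor
  · rintro ⟨y, hy⟩
    exact ⟨⟨y, hy.right_mem⟩, hy⟩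
  · rintro ⟨w, hw⟩
    exact ⟨w, hw⟩

theorem crossDeg_comm (A B : Set V(G)) (v : V(G)) : crossDeg G A B v = crossDeg G B A v := by
  unfold crossDeg
  congr 1
  ext e
  constructor
  all_goals
    rintro ⟨h, a, ha, b, hb, hl⟩
    exact ⟨h, b, hb, a, ha, hl.symm⟩

open Classical in
theorem crossDeg_of_mem_left [Fintype V(G)] [Finite E(G)] {A B : Set V(G)} (hAB : Disjoint A B)
    {v : V(G)} (hv : v ∈ A) : crossDeg G A B v = ∑ w, if w ∈ B then mult G v w else 0 := by
  rw [← ncard_edges_to, crossDeg]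
  congr 1
  ext e
  constructor
  · rintro ⟨h, a, ha, b, hb, hl⟩
    rcases h.eq_or_eq_of_isLink hl with h | h
    · exact ⟨b, hb, h ▸ hl⟩
    · exact (Set.disjoint_left.1 hAB hv ((Subtype.ext h : v = b) ▸ hb)).elim
  · rintro ⟨w, hw, hl⟩
    exact ⟨⟨w, hl⟩, v, hv, w, hw, hl⟩

end Multiplicities

/-! ### The Laplacian as a firing rule. -/

section Laplacian

variable [Fintype V(G)]

open Classical in
theorem laplacian_mulVec_single_self (v : V(G)) :
    (laplacian G).mulVec (Pi.single v 1) v = deg G v := by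
  rw [Matrix.mulVec_single_one]
  simp [laplacian]

open Classical in
theorem laplacian_mulVec_single_of_ne {v w : V(G)} (h : w ≠ v) :
    (laplacian G).mulVec (Pi.single v 1) w = -mult G w v := by
  rw [Matrix.mulVec_single_one]
  simp [laplacian, h]

variable [G.Loopless]

theorem laplacian_mulVec_apply (σ : V(G) → ℤ) (v : V(G)) :
    (laplacian G).mulVec σ v = deg G v * σ v - ∑ w, mult G v w * σ w := by
  classical
  have h : ∀ w, laplacian G v w * σ w =
      (if v = w then (deg G v : ℤ) * σ w else 0) - mult G v w * σ w := by
    intro w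
    by_cases hvw : v = w
    · subst hvw
      simp [laplacian, mult_self]
    · simp [laplacian, hvw]
  simp only [Matrix.mulVec, dotProduct, h, Finset.sum_sub_distrib, Finset.sum_ite_eq,
    Finset.mem_univ, if_true]

variable [Finite E(G)]

theorem laplacian_mulVec_apply_eq_sum_sub (σ : V(G) → ℤ) (v : V(G)) :
    (laplacian G).mulVec σ v = ∑ w, (mult G v w : ℤ) * (σ v - σ w) := by
  rw [laplacian_mulVec_apply, deg_eq_sum_mult]
  push_cast
  simp only [mul_sub, Finset.sum_sub_distrib, Finset.sum_mul]

theorem sum_laplacian_mulVec (σ : V(G) → ℤ) : ∑ v, (laplacian G).mulVec σ v = 0 := by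
  simp only [laplacian_mulVec_apply_eq_sum_sub, mul_sub, Finset.sum_sub_distrib]
  rw [sub_eq_zero, Finset.sum_comm]
  simp only [mult_comm G]

end Laplacian

/-! ### Invariance under linear equivalence. -/

section Equivalence

variable {G} [Fintype V(G)] {D₀ D₁ D₂ : V(G) → ℤ}

theorem Equivalent.symm (h : Equivalent G D₀ D₁) : Equivalent G D₁ D₀ := by
  obtain ⟨σ, rfl⟩ := h
  exact ⟨-σ, by simp [Matrix.mulVec_neg]⟩

theorem Equivalent.trans (h : Equivalent G D₀ D₁) (h' : Equivalent G D₁ D₂) :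
    Equivalent G D₀ D₂ := by
  obtain ⟨σ, rfl⟩ := h
  obtain ⟨τ, rfl⟩ := h'
  exact ⟨σ + τ, by rw [Matrix.mulVec_add, sub_sub]⟩

theorem Equivalent.sub_right (h : Equivalent G D₀ D₁) (H : V(G) → ℤ) :
    Equivalent G (D₀ - H) (D₁ - H) := by
  obtain ⟨σ, rfl⟩ := h
  exact ⟨σ, sub_right_comm _ _ _⟩

theorem Alive.congr (h : Equivalent G D₀ D₁) (hD : Alive G D₀) : Alive G D₁ := by
  rintro ⟨D', ⟨he, h0⟩, hs⟩
  exact hD ⟨D', ⟨h.trans he, h0⟩, hs⟩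

theorem MinimallyAlive.congr (h : Equivalent G D₀ D₁) (hD : MinimallyAlive G D₀) :
    MinimallyAlive G D₁ :=
  ⟨hD.1.congr h, fun v hv => hD.2 v (hv.congr (h.symm.sub_right _))⟩

end Equivalence

/-! ### Boundedness of scripts that never fire a given vertex. -/

section Scripts

variable [Fintype V(G)] [Finite E(G)] [G.Loopless]

/-- Firing scripts that fix a vertex and lead from a given divisor to divisors that are bounded
from above are bounded. -/
theorem exists_script_bound (hconn : G.toSimpleGraph.Connected) (F : V(G) → ℤ) (N : ℤ)
    (q : V(G)) :
    ∃ M : ℤ, ∀ τ : V(G) → ℤ, 0 ≤ τ → τ q = 0 →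
      (∀ v, (F - (laplacian G).mulVec τ) v ≤ N) → ∑ v, τ v ≤ M := by
  have key : ∀ v, ∃ M : ℤ, ∀ τ : V(G) → ℤ, 0 ≤ τ → τ q = 0 →
      (∀ v, (F - (laplacian G).mulVec τ) v ≤ N) → τ v ≤ M := by
    intro v
    have hr : Relation.ReflTransGen G.toSimpleGraph.Adj q v :=
      (SimpleGraph.reachable_iff_reflTransGen q v).1 (hconn.preconnected q v)
    induction hr with
    | refl => exact ⟨0, fun τ _ h _ => h.le⟩
    | @tail w u _ hwu ih =>
      obtain ⟨M, hM⟩ := ih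
      -- `w` loses at most `deg G w * M` chips and ends with at most `N`, which bounds the chips
      -- received from its neighbour `u`.
      refine ⟨N - F w + deg G w * M, fun τ h0 hq hN => ?_⟩
      have h1 := hN w
      rw [Pi.sub_apply, laplacian_mulVec_apply] at h1
      have h2 : (mult G w u : ℤ) * τ u ≤ ∑ x, (mult G w x : ℤ) * τ x :=
        Finset.single_le_sum (f := fun x => (mult G w x : ℤ) * τ x)
          (fun x _ => mul_nonneg (Int.natCast_nonneg _) (h0 x)) (Finset.mem_univ u)
      have h3 : (1 : ℤ) ≤ mult G w u := by exact_mod_cast mult_pos_of_adj G hwu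
      have h4 : τ u ≤ (mult G w u : ℤ) * τ u := le_mul_of_one_le_left (h0 u) h3
      have h5 : (deg G w : ℤ) * τ w ≤ deg G w * M :=
        mul_le_mul_of_nonneg_left (hM τ h0 hq hN) (Int.natCast_nonneg _)
      linarith
  choose M hM using key
  exact ⟨∑ v, M v, fun τ h0 hq hN => Finset.sum_le_sum fun v _ => hM v τ h0 hq hN⟩

end Scripts

/-! ### Acyclic orientations and minimally alive divisors. -/

section OrderDivisor

variable [Fintype V(G)]

/-- The divisor of in-degrees of the acyclic orientation in which edges point towards the endpoint
with the smaller value of `t`. -/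
noncomputable def orderDivisor (t : V(G) → ℕ) (v : V(G)) : ℤ :=
  ∑ w, if t v < t w then (mult G v w : ℤ) else 0

theorem orderDivisor_nonneg (t : V(G) → ℕ) : 0 ≤ orderDivisor G t := fun v =>
  Finset.sum_nonneg fun w _ => by split_ifs <;> simp

/-- Legal firing sequences of any length starting at an alive effective divisor; `t` records the
time at which a vertex was last fired. -/
theorem exists_legal_script {F : V(G) → ℤ} (hF : 0 ≤ F) (ha : Alive G F) (m : ℕ) :
    ∃ (τ : V(G) → ℤ) (t : V(G) → ℕ), 0 ≤ τ ∧ ∑ v, τ v = m ∧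
      0 ≤ F - (laplacian G).mulVec τ ∧ (∀ v, t v ≤ m) ∧
      (∀ v w, 0 < τ v → 0 < τ w → t v = t w → v = w) ∧
      ∀ v, 0 < τ v → orderDivisor G t v ≤ (F - (laplacian G).mulVec τ) v := by
  classical
  induction m with
  | zero => exact ⟨0, 0, le_rfl, by simp, by simpa using hF, by simp, by simp, by simp⟩
  | succ m ih =>
    obtain ⟨τ, t, h0, hs, hE, ht, hi, hO⟩ := ih
    obtain ⟨v, hv⟩ : Unstable G (F - (laplacian G).mulVec τ) := by
      by_contra hst
      exact ha ⟨_, ⟨⟨τ, rfl⟩, hE⟩, hst⟩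
    set E := F - (laplacian G).mulVec τ with hEdef
    have hfire : F - (laplacian G).mulVec (τ + Pi.single v 1) =
        E - (laplacian G).mulVec (Pi.single v 1) := by
      rw [Matrix.mulVec_add, ← sub_sub]
    have hpos : ∀ w, w ≠ v → 0 < (τ + Pi.single v 1 : V(G) → ℤ) w → 0 < τ w := by
      intro w hw h
      simpa [hw] using h
    -- The new time exceeds all earlier ones; vertices not yet fired keep the default time 0.
    refine ⟨τ + Pi.single v 1, Function.update t v (m + 1), add_nonneg h0 (by simp), ?_, ?_, ?_,
      ?_, ?_⟩
    · simp [Finset.sum_add_distrib, hs]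
    · rw [hfire]
      intro w
      by_cases hw : w = v
      · subst hw
        rw [Pi.sub_apply, laplacian_mulVec_single_self]
        exact sub_nonneg.2 hv
      · simp only [Pi.zero_apply, Pi.sub_apply, laplacian_mulVec_single_of_ne G hw]
        rw [sub_neg_eq_add]
        exact add_nonneg (hE w) (Int.natCast_nonneg _)
    · intro w
      by_cases hw : w = v
      · subst hw
        simp
      · rw [Function.update_of_ne hw]
        exact (ht w).trans (Nat.le_succ m)
    · intro a b ha hb hab
      by_cases hav : a = v <;> by_cases hbv : b = v
      · rw [hav, hbv]
      · rw [hav, Function.update_self, Function.update_of_ne hbv] at hab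
        have := ht b
        omega
      · rw [hbv, Function.update_self, Function.update_of_ne hav] at hab
        have := ht a
        omega
      · rw [Function.update_of_ne hav, Function.update_of_ne hbv] at hab
        exact hi a b (hpos a hav ha) (hpos b hbv hb) hab
    · intro w hw
      rw [hfire, Pi.sub_apply]
      by_cases hwv : w = v
      · subst hwv
        -- Nothing has fired after the vertex just fired, so its lower bound is 0.
        rw [laplacian_mulVec_single_self]
        refine le_trans (le_of_eq (Finset.sum_eq_zero fun u _ => if_neg ?_)) (sub_nonneg.2 hv)
        rw [Function.update_self, not_lt]
        by_cases huw : u = w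
        · rw [huw, Function.update_self]
        · rw [Function.update_of_ne huw]
          exact (ht u).trans (Nat.le_succ m)
      -- Any other `w` gains `mult G w v` chips, and its lower bound grows by at most that.
      · rw [laplacian_mulVec_single_of_ne G hwv, sub_neg_eq_add]
        refine le_trans ?_ (add_le_add_left (hO w (hpos w hwv hw)) _)
        rw [orderDivisor, orderDivisor, ← Finset.add_sum_erase _ _ (Finset.mem_univ v),
          ← Finset.add_sum_erase _ _ (Finset.mem_univ v)]
        have h1 : (if Function.update t v (m + 1) w < Function.update t v (m + 1) v
            then (mult G w v : ℤ) else 0) ≤ mult G w v := by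
          split_ifs <;> simp
        have h2 : (0 : ℤ) ≤ if t w < t v then (mult G w v : ℤ) else 0 := by
          split_ifs <;> simp
        have h3 : ∑ u ∈ Finset.univ.erase v, (if Function.update t v (m + 1) w <
            Function.update t v (m + 1) u then (mult G w u : ℤ) else 0) =
            ∑ u ∈ Finset.univ.erase v, if t w < t u then (mult G w u : ℤ) else 0 := by
          refine Finset.sum_congr rfl fun u hu => ?_
          rw [Function.update_of_ne (Finset.ne_of_mem_erase hu), Function.update_of_ne hwv]
        rw [h3]
        linarith

variable [Finite E(G)]

theorem orderDivisor_le_deg (t : V(G) → ℕ) (v : V(G)) : orderDivisor G t v ≤ deg G v := by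
  rw [deg_eq_sum_mult]
  push_cast
  exact Finset.sum_le_sum fun w _ => by split_ifs <;> simp

theorem orderDivisor_lt_deg {t : V(G) → ℕ} {v w : V(G)} (hvw : 0 < mult G v w) (h : t w < t v) :
    orderDivisor G t v < deg G v := by
  rw [deg_eq_sum_mult]
  push_cast
  refine Finset.sum_lt_sum (fun w _ => by split_ifs <;> simp) ⟨w, Finset.mem_univ w, ?_⟩
  rw [if_neg h.le.not_gt]
  exact_mod_cast hvw

variable [G.Loopless]

theorem orderDivisor_eq_deg {t : V(G) → ℕ} (ht : t.Injective) {v : V(G)}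
    (h : ∀ w, 0 < mult G v w → ¬ t w < t v) : orderDivisor G t v = deg G v := by
  rw [deg_eq_sum_mult]
  push_cast
  refine Finset.sum_congr rfl fun w _ => ?_
  rcases Nat.eq_zero_or_pos (mult G v w) with h0 | h0
  · simp [h0]
  · refine if_pos (lt_of_le_of_ne (not_lt.1 (h w h0)) fun htt => ?_)
    rw [ht htt, mult_self] at h0
    exact h0.false

/-- Every divisor that dominates the divisor of an acyclic orientation is alive. -/
theorem alive_of_orderDivisor_le [Nonempty V(G)] {t : V(G) → ℕ} (ht : t.Injective)
    {D : V(G) → ℤ} (hD : orderDivisor G t ≤ D) : Alive G D := by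
  rintro ⟨D', ⟨⟨σ, rfl⟩, -⟩, hs⟩
  apply hs
  -- At a lexicographic minimum of `(σ, t)`, each edge to a neighbour `w` accounts for a chip:
  -- either `σ v < σ w`, or `σ` ties and the edge points to `v`.
  obtain ⟨v, -, hv⟩ := Finset.exists_min_image Finset.univ (fun v => toLex (σ v, t v))
    Finset.univ_nonempty
  refine ⟨v, ?_⟩
  rw [Pi.sub_apply, laplacian_mulVec_apply_eq_sum_sub]
  have h1 := hD v
  suffices (deg G v : ℤ) + ∑ w, (mult G v w : ℤ) * (σ v - σ w) ≤ orderDivisor G t v by linarith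
  rw [deg_eq_sum_mult]
  push_cast
  rw [orderDivisor, ← Finset.sum_add_distrib]
  refine Finset.sum_le_sum fun w hw => ?_
  by_cases hvw : v = w
  · subst hvw
    simp [mult_self]
  have hm : (0 : ℤ) ≤ mult G v w := Int.natCast_nonneg _
  rcases (Prod.Lex.toLex_le_toLex.1 (hv w hw)) with h | ⟨h, h'⟩
  · split_ifs <;> nlinarith
  · rw [if_pos (lt_of_le_of_ne h' fun e => hvw (ht e))]
    simp only at h
    simp [h]

open Classical in
/-- Firing a sink of an acyclic orientation turns it into a source. -/
theorem exists_orderDivisor_eq_fire {t : V(G) → ℕ} (ht : t.Injective) {v : V(G)}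
    (h : ∀ w, 0 < mult G v w → ¬ t w < t v) :
    ∃ t' : V(G) → ℕ, t'.Injective ∧
      orderDivisor G t - (laplacian G).mulVec (Pi.single v 1) = orderDivisor G t' := by
  have hlt : ∀ w, t w < ∑ u, t u + 1 := fun w =>
    Nat.lt_succ_of_le (Finset.single_le_sum (fun _ _ => Nat.zero_le _) (Finset.mem_univ w))
  -- Any value above all of `t` would do: it makes `v` a source.
  refine ⟨Function.update t v (∑ u, t u + 1), ?_, ?_⟩
  · intro a b hab
    by_cases ha : a = v <;> by_cases hb : b = v
    · rw [ha, hb]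
    · subst ha
      simp only [Function.update_self, Function.update_of_ne hb] at hab
      exact absurd hab.symm (hlt b).ne
    · subst hb
      simp only [Function.update_self, Function.update_of_ne ha] at hab
      exact absurd hab (hlt a).ne
    · simp only [Function.update_of_ne ha, Function.update_of_ne hb] at hab
      exact ht hab
  · ext w
    rw [Pi.sub_apply]
    by_cases hw : w = v
    · subst hw
      rw [orderDivisor_eq_deg G ht h, laplacian_mulVec_single_self, sub_self, eq_comm]
      refine Finset.sum_eq_zero fun u _ => ?_
      by_cases hu : u = w
      · subst hu
        simp
      · rw [Function.update_self, Function.update_of_ne hu, if_neg (hlt u).not_gt]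
    · rw [laplacian_mulVec_single_of_ne G hw, sub_neg_eq_add, orderDivisor, orderDivisor,
        ← Finset.add_sum_erase _ _ (Finset.mem_univ v),
        ← Finset.add_sum_erase _ _ (Finset.mem_univ v)]
      have h1 : (if t w < t v then (mult G w v : ℤ) else 0) = 0 := by
        split_ifs with htw
        · have := h w
          rw [mult_comm] at this
          have h0 : mult G w v = 0 := by
            by_contra h0
            exact this (Nat.pos_of_ne_zero h0) htw
          simp [h0]
        · rfl
      rw [h1, Function.update_self, Function.update_of_ne hw, if_pos (hlt w), zero_add, add_comm]
      congr 1
      refine Finset.sum_congr rfl fun u hu => ?_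
      rw [Function.update_of_ne (Finset.ne_of_mem_erase hu)]

/-- Up to equivalence, an acyclic orientation has a prescribed vertex as its only sink. -/
theorem exists_equivalent_orderDivisor_unique_sink (hconn : G.toSimpleGraph.Connected)
    {t : V(G) → ℕ} (ht : t.Injective) (q : V(G)) :
    ∃ t' : V(G) → ℕ, t'.Injective ∧ Equivalent G (orderDivisor G t) (orderDivisor G t') ∧
      ∀ w, w ≠ q → ∃ u, 0 < mult G w u ∧ t' u < t' w := by
  classical
  -- Otherwise some sink other than `q` can always be fired, giving arbitrarily long scripts that
  -- avoid `q`, although in-degrees stay bounded.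
  by_contra! hcon
  have key : ∀ m : ℕ, ∃ (τ : V(G) → ℤ) (t' : V(G) → ℕ), 0 ≤ τ ∧ τ q = 0 ∧ ∑ v, τ v = m ∧
      t'.Injective ∧ orderDivisor G t - (laplacian G).mulVec τ = orderDivisor G t' := by
    intro m
    induction m with
    | zero => exact ⟨0, t, le_rfl, rfl, by simp, ht, by simp⟩
    | succ m ih =>
      obtain ⟨τ, t', h0, hq, hs, hi, he⟩ := ih
      obtain ⟨w, hwq, hw⟩ := hcon t' hi ⟨τ, he⟩
      obtain ⟨t'', hi', he'⟩ := exists_orderDivisor_eq_fire G hi fun u hu => (hw u hu).not_gt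
      refine ⟨τ + Pi.single w 1, t'', add_nonneg h0 (by simp), ?_, ?_, hi', ?_⟩
      · simp [hq, Ne.symm hwq]
      · simp [Finset.sum_add_distrib, hs]
      · rw [Matrix.mulVec_add, ← sub_sub, he, he']
  obtain ⟨M, hM⟩ := exists_script_bound G hconn (orderDivisor G t) (∑ v, (deg G v : ℤ)) q
  obtain ⟨τ, t', h0, hq, hs, -, he⟩ := key (M.toNat + 1)
  have := hM τ h0 hq fun v => by
    rw [he]
    exact (orderDivisor_le_deg G t' v).trans
      (Finset.single_le_sum (f := fun v => (deg G v : ℤ)) (fun _ _ => Int.natCast_nonneg _)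
        (Finset.mem_univ v))
  rw [hs] at this
  omega

/-- The divisors of acyclic orientations are minimally alive. -/
theorem minimallyAlive_orderDivisor (hconn : G.toSimpleGraph.Connected)
    (hn : 2 ≤ Fintype.card V(G)) {t : V(G) → ℕ} (ht : t.Injective) :
    MinimallyAlive G (orderDivisor G t) := by
  classical
  have : Nonempty V(G) := hconn.nonempty
  have : Nontrivial V(G) := Fintype.one_lt_card_iff_nontrivial.1 hn
  refine ⟨alive_of_orderDivisor_le G ht le_rfl, fun v => ?_⟩
  obtain ⟨t', ht', he, hv⟩ := exists_equivalent_orderDivisor_unique_sink G hconn ht v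
  -- Two vertices are needed here: the sink `v` must have a chip to lose.
  have hdeg : (1 : ℤ) ≤ deg G v := by
    obtain ⟨w, hw⟩ := hconn.preconnected.exists_adj_of_nontrivial v
    have h1 := mult_pos_of_adj G hw
    have h2 : mult G v w ≤ deg G v := by
      rw [deg_eq_sum_mult]
      exact Finset.single_le_sum (f := mult G v) (fun _ _ => Nat.zero_le _) (Finset.mem_univ w)
    exact_mod_cast h1.trans_le h2
  -- A global minimum of `t'` is a sink, hence is `v`.
  have hmin : ∀ w, t' v ≤ t' w := by
    obtain ⟨w₀, hw₀⟩ := Finite.exists_min t'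
    have : w₀ = v := by
      by_contra hne
      obtain ⟨u, -, hu⟩ := hv w₀ hne
      exact hu.not_ge (hw₀ u)
    exact this ▸ hw₀
  have hD : orderDivisor G t' v = deg G v :=
    orderDivisor_eq_deg G ht' fun w _ => (hmin w).not_gt
  rw [Alive, not_not]
  refine ⟨_, ⟨he.sub_right _, fun w => ?_⟩, ?_⟩
  · by_cases hw : w = v
    · subst hw
      simp [hD, hdeg]
    · simpa [hw] using orderDivisor_nonneg G t' w
  · rintro ⟨w, hw⟩
    by_cases hwv : w = v
    · subst hwv
      simp [hD] at hw
    · obtain ⟨u, hu, htu⟩ := hv w hwv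
      have := orderDivisor_lt_deg G hu htu
      simp only [Pi.sub_apply, Pi.single_eq_of_ne hwv, sub_zero] at hw
      exact hw.not_gt this

/-- An alive effective divisor is equivalent to one that dominates the divisor of an acyclic
orientation. -/
theorem exists_equivalent_orderDivisor_le (hconn : G.toSimpleGraph.Connected) {F : V(G) → ℤ}
    (hF : 0 ≤ F) (ha : Alive G F) :
    ∃ (F' : V(G) → ℤ) (t : V(G) → ℕ), Equivalent G F F' ∧ t.Injective ∧
      orderDivisor G t ≤ F' := by
  -- Firing preserves the total, so effective divisors in the class have entries at most `∑ v, F v`.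
  -- A script longer than every `M q` must fire every vertex.
  choose M hM using exists_script_bound G hconn F (∑ v, F v)
  obtain ⟨τ, t, h0, hs, hE, -, hi, hO⟩ := exists_legal_script G hF ha (∑ q, (M q).toNat + 1)
  have hle : ∀ v, (F - (laplacian G).mulVec τ) v ≤ ∑ v, F v := by
    intro v
    have h1 : ∑ w, (F - (laplacian G).mulVec τ) w = ∑ w, F w := by
      simp [Finset.sum_sub_distrib, sum_laplacian_mulVec]
    rw [← h1]
    exact Finset.single_le_sum (f := F - (laplacian G).mulVec τ) (fun w _ => hE w)
      (Finset.mem_univ v)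
  have hpos : ∀ q, 0 < τ q := by
    intro q
    refine lt_of_le_of_ne (h0 q) fun hq => ?_
    have h1 := hM q τ h0 hq.symm hle
    have h2 : (M q).toNat ≤ ∑ q, (M q).toNat :=
      Finset.single_le_sum (f := fun q => (M q).toNat) (fun _ _ => Nat.zero_le _)
        (Finset.mem_univ q)
    rw [hs] at h1
    omega
  exact ⟨_, t, ⟨τ, rfl⟩, fun v w h => hi v w (hpos v) (hpos w) h, fun v => hO v (hpos v)⟩

/-- A minimally alive divisor is equivalent to the divisor of an acyclic orientation. -/
theorem MinimallyAlive.exists_equivalent_orderDivisor (hconn : G.toSimpleGraph.Connected)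
    {D : V(G) → ℤ} (hD : MinimallyAlive G D) :
    ∃ t : V(G) → ℕ, t.Injective ∧ Equivalent G D (orderDivisor G t) := by
  classical
  obtain ⟨q⟩ : Nonempty V(G) := hconn.nonempty
  have : Nonempty V(G) := ⟨q⟩
  -- A stable effective representative of `D - 1_q` plus the chip at `q` is an effective
  -- representative of `D`.
  obtain ⟨F, ⟨⟨σ, hσ⟩, hF⟩, -⟩ := not_not.1 (hD.2 q)
  have he : Equivalent G D (F + Pi.single q 1) := ⟨σ, by rw [← hσ]; abel⟩
  obtain ⟨F', t, he', ht, hle⟩ := exists_equivalent_orderDivisor_le G hconn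
    (add_nonneg hF (by simp)) (hD.1.congr he)
  refine ⟨t, ht, ?_⟩
  suffices orderDivisor G t = F' by
    rw [this]
    exact he.trans he'
  ext v
  -- A spare chip at `v` could be removed without losing domination, hence aliveness.
  refine le_antisymm (hle v) (not_lt.1 fun hlt => hD.2 v ?_)
  refine Alive.congr ((he.trans he').sub_right _).symm (alive_of_orderDivisor_le G ht fun w => ?_)
  by_cases hw : w = v
  · subst hw
    simpa using Int.le_sub_one_of_lt hlt
  · simpa [hw] using hle w

end OrderDivisor

/-! ### Generating sequences and orientations. -/

section GeneratingSequences

variable {G}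

theorem IsGeneratingSequence.isFreeGeneratingSequence {P : Set (Set V(G))} {k : ℕ}
    {A B : ℕ → Set V(G)} (h : IsGeneratingSequence G P k A B) :
    IsFreeGeneratingSequence G P k A B := by
  refine ⟨fun i hi => ?_, h.produces⟩
  cases i with
  | zero => exact ⟨Set.univ, rfl, h.first hi⟩
  | succ i =>
    rcases h.next i hi with hc | hc
    · exact ⟨A i, Or.inl rfl, hc⟩
    · exact ⟨B i, Or.inr (Or.inl rfl), hc⟩

theorem IsCut.swap {S A B : Set V(G)} (h : IsCut G S A B) : IsCut G S B A :=
  ⟨(Set.union_comm B A).trans h.union_eq, h.disjoint.symm, h.connected_right, h.connected_left⟩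

theorem ConnectedSet.nonempty {S : Set V(G)} (h : ConnectedSet G S) : S.Nonempty :=
  Set.nonempty_coe_sort.1 (SimpleGraph.Connected.nonempty h)

variable (G) in
/-- The partition of the vertices into the level sets of `t`. -/
def levelSets (t : V(G) → ℕ) : Set (Set V(G)) := {S | ∃ v, S = {w | t w = t v}}

theorem levelSets_eq_range_singleton_iff {t : V(G) → ℕ} :
    levelSets G t = Set.range singleton ↔ t.Injective := by
  constructor
  · intro h v w hvw
    obtain ⟨u, hu⟩ : {x | t x = t v} ∈ Set.range singleton := h ▸ ⟨v, rfl⟩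
    have hv : v ∈ {x | t x = t v} := rfl
    have hw : w ∈ {x | t x = t v} := hvw.symm
    rw [← hu, Set.mem_singleton_iff] at hv hw
    rw [hv, hw]
  · intro h
    have hs : ∀ v, {w | t w = t v} = {v} := fun v => by
      ext w
      simp [h.eq_iff]
    ext S
    simp only [levelSets, hs, Set.mem_range, Set.mem_ofPred_eq]
    exact exists_congr fun v => eq_comm

theorem connectedSet_singleton (v : V(G)) : ConnectedSet G {v} := by
  refine (SimpleGraph.connected_iff_exists_forall_reachable _).2 ⟨⟨v, rfl⟩, ?_⟩
  rintro ⟨w, rfl⟩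
  rfl

variable [Fintype V(G)]

/-- The values of an injective function, in decreasing order, can be replaced by the first
natural numbers. -/
theorem exists_rank {t : V(G) → ℕ} (ht : t.Injective) :
    ∃ r : V(G) → ℕ, (∀ v, r v < Fintype.card V(G)) ∧ ∀ v w, r v < r w ↔ t w < t v := by
  let r : V(G) → ℕ := fun v => (Finset.univ.filter fun w => t v < t w).card
  have hlt : ∀ v w, t w < t v → r v < r w := by
    intro v w h
    refine Finset.card_lt_card ((Finset.ssubset_iff_of_subset fun u hu => ?_).2 ⟨v, ?_, ?_⟩)
    · simp only [Finset.mem_filter, Finset.mem_univ, true_and] at hu ⊢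
      exact h.trans hu
    · simpa using h
    · simp
  refine ⟨r, fun v => ?_, fun v w => ⟨fun h => ?_, hlt v w⟩⟩
  · exact Finset.card_lt_univ_of_notMem (x := v) (by simp)
  · by_contra hn
    rcases (not_lt.1 hn).lt_or_eq with h' | h'
    · exact h.not_gt (hlt w v h')
    · exact h.ne (congrArg r (ht h'))

variable [Finite E(G)]

open Classical in
/-- Cutting a level set refines the orientation by directing the crossing edges. -/
theorem IsCut.exists_refinement {t : V(G) → ℕ} {S A B : Set V(G)} (hS : S ∈ levelSets G t)
    (h : IsCut G S A B) :
    ∃ t' : V(G) → ℕ, levelSets G t' = insert A (insert B (levelSets G t \ {A ∪ B})) ∧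
      ∀ v, orderDivisor G t' v =
        orderDivisor G t v + if v ∈ A then (crossDeg G A B v : ℤ) else 0 := by
  obtain ⟨v₀, rfl⟩ := hS
  have hmem : ∀ w, t w = t v₀ ↔ w ∈ A ∨ w ∈ B := fun w => by
    rw [← Set.mem_union, h.union_eq, Set.mem_ofPred_eq]
  have hdisj : ∀ w, w ∈ A → w ∉ B := fun w hw => Set.disjoint_left.1 h.disjoint hw
  -- Doubling makes room to put `B` just above `A`, leaving comparisons between different levels
  -- intact.
  refine ⟨fun v => 2 * t v + if v ∈ B then 1 else 0, ?_, fun v => ?_⟩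
  · have hA : ∀ v ∈ A, {w | (2 * t w + if w ∈ B then 1 else 0) =
        2 * t v + if v ∈ B then 1 else 0} = A := by
      intro v hv
      ext w
      have h1 := hmem w
      have h2 := (hmem v).2 (Or.inl hv)
      have h3 := hdisj w
      simp only [Set.mem_ofPred_eq, if_neg (hdisj v hv)]
      split_ifs with hw
      · constructor
        · intro; omega
        · intro hwA; exact absurd hw (h3 hwA)
      · constructor
        · intro hw'
          exact (h1.1 (by omega)).resolve_right hw
        · intro hwA
          have := h1.2 (Or.inl hwA)
          omega
    have hB : ∀ v ∈ B, {w | (2 * t w + if w ∈ B then 1 else 0) =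
        2 * t v + if v ∈ B then 1 else 0} = B := by
      intro v hv
      ext w
      have h1 := hmem w
      have h2 := (hmem v).2 (Or.inr hv)
      simp only [Set.mem_ofPred_eq, if_pos hv]
      split_ifs with hw
      · have := h1.2 (Or.inr hw)
        simp only [hw, iff_true]
        omega
      · simp only [hw, iff_false]
        omega
    have hC : ∀ v, v ∉ A → v ∉ B → {w | (2 * t w + if w ∈ B then 1 else 0) =
        2 * t v + if v ∈ B then 1 else 0} = {w | t w = t v} := by
      intro v hvA hvB
      ext w
      have h1 := hmem w
      have h2 := hmem v
      simp only [Set.mem_ofPred_eq, if_neg hvB]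
      simp only [hvA, hvB, or_self, iff_false] at h2
      split_ifs with hw
      · have := h1.2 (Or.inr hw)
        constructor <;> intro <;> omega
      · constructor <;> intro <;> omega
    have hne : ∀ v, v ∉ A → v ∉ B → {w | t w = t v} ≠ A ∪ B := by
      intro v hvA hvB he
      have : v ∈ A ∪ B := he ▸ (rfl : t v = t v)
      exact this.elim hvA hvB
    ext T
    constructor
    · rintro ⟨v, rfl⟩
      by_cases hvA : v ∈ A
      · exact Or.inl (hA v hvA)
      by_cases hvB : v ∈ B
      · exact Or.inr (Or.inl (hB v hvB))
      · refine Or.inr (Or.inr ?_)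
        rw [hC v hvA hvB]
        exact ⟨⟨v, rfl⟩, hne v hvA hvB⟩
    · rintro (rfl | rfl | ⟨⟨v, rfl⟩, hv⟩)
      · obtain ⟨v, hv⟩ := h.connected_left.nonempty
        exact ⟨v, (hA v hv).symm⟩
      · obtain ⟨v, hv⟩ := h.connected_right.nonempty
        exact ⟨v, (hB v hv).symm⟩
      · have hv' : ¬ (v ∈ A ∨ v ∈ B) := by
          rw [← hmem]
          intro hvt
          apply hv
          rw [Set.mem_singleton_iff, h.union_eq, hvt]
        rw [not_or] at hv'
        exact ⟨v, (hC v hv'.1 hv'.2).symm⟩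
  · have hcross : (if v ∈ A then (crossDeg G A B v : ℤ) else 0) =
        ∑ w, if v ∈ A ∧ w ∈ B then (mult G v w : ℤ) else 0 := by
      by_cases hv : v ∈ A
      · rw [if_pos hv, crossDeg_of_mem_left G h.disjoint hv]
        push_cast
        simp [hv]
      · simp [hv]
    rw [hcross, orderDivisor, orderDivisor, ← Finset.sum_add_distrib]
    refine Finset.sum_congr rfl fun w _ => ?_
    have h1 := hmem v
    have h2 := hmem w
    have h3 := hdisj v
    have h4 := hdisj w
    have hlt : ((2 * t v + if v ∈ B then 1 else 0) < 2 * t w + if w ∈ B then 1 else 0) ↔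
        t v < t w ∨ v ∈ A ∧ w ∈ B := by
      grind
    by_cases hvw : v ∈ A ∧ w ∈ B
    · have : ¬ t v < t w := by grind
      simp only [if_pos (hlt.2 (Or.inr hvw)), if_neg this, if_pos hvw, zero_add]
    · simp only [hlt, hvw, or_false, if_false, add_zero]

/-- Boundary divisors of free generating sequences of the partition into singletons come from
acyclic orientations. -/
theorem IsFreeGeneratingSequence.exists_eq_orderDivisor {P : Set (Set V(G))} {k : ℕ}
    {A B : ℕ → Set V(G)} (h : IsFreeGeneratingSequence G P k A B) {D : V(G) → ℤ}
    (hD : ArisesFrom G k A B D) (hconn : G.toSimpleGraph.Connected) :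
    ∃ t : V(G) → ℕ, levelSets G t = P ∧ D = orderDivisor G t := by
  classical
  obtain ⟨X, hX, hDX⟩ := hD
  have : Nonempty V(G) := hconn.nonempty
  have key : ∀ i ≤ k, ∃ t : V(G) → ℕ, levelSets G t = partitionAfter G A B i ∧
      ∀ v, orderDivisor G t v =
        ∑ j ∈ Finset.range i, if v ∈ X j then (crossDeg G (A j) (B j) v : ℤ) else 0 := by
    intro i
    induction i with
    | zero =>
      -- A constant `t` has the single block `V` and directs no edge.
      refine fun _ => ⟨0, ?_, by simp [orderDivisor]⟩
      ext S
      simp [levelSets, partitionAfter]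
    | succ i ih =>
      intro hi
      obtain ⟨t, ht, hO⟩ := ih (Nat.le_of_succ_le hi)
      obtain ⟨S, hS, hcut⟩ := h.cut i hi
      rw [← ht] at hS
      rcases hX i hi with hx | hx
      · obtain ⟨t', ht', hO'⟩ := hcut.exists_refinement hS
        refine ⟨t', by rw [ht', ht, partitionAfter], fun v => ?_⟩
        rw [hO', hO, Finset.sum_range_succ, hx]
      · obtain ⟨t', ht', hO'⟩ := hcut.swap.exists_refinement hS
        refine ⟨t', by rw [ht', ht, partitionAfter, Set.insert_comm, Set.union_comm], fun v => ?_⟩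
        rw [hO', hO, Finset.sum_range_succ, hx, crossDeg_comm]
  obtain ⟨t, ht, hO⟩ := key k le_rfl
  exact ⟨t, ht.trans h.produces, funext fun v => (hDX v).trans (hO v).symm⟩

variable [G.Loopless]

/-- An acyclic orientation with a single sink comes from a generating sequence that splits off
the vertices one at a time. -/
theorem isBoundaryDivisor_orderDivisor (hconn : G.toSimpleGraph.Connected) {t : V(G) → ℕ}
    (ht : t.Injective) {q : V(G)} (hq : ∀ w, w ≠ q → ∃ u, 0 < mult G w u ∧ t u < t w) :
    IsBoundaryDivisor G (Set.range singleton) (orderDivisor G t) := by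
  classical
  have : Nonempty V(G) := hconn.nonempty
  -- Ranks decrease with `t`: removal starts at a source, and the sink `q` comes last.
  obtain ⟨r, hr, hrt⟩ := exists_rank ht
  have hinj : r.Injective := fun v w h => by
    have h1 := hrt v w
    have h2 := hrt w v
    exact ht (by omega)
  have hcard : 0 < Fintype.card V(G) := Fintype.card_pos
  have hsurj : ∀ i < Fintype.card V(G), ∃ v, r v = i := by
    have hb : Function.Bijective fun v => (⟨r v, hr v⟩ : Fin (Fintype.card V(G))) :=
      (Fintype.bijective_iff_injective_and_card _).2
        ⟨fun v w h => hinj (Fin.mk.inj_iff.1 h), by simp⟩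
    intro i hi
    obtain ⟨v, hv⟩ := hb.2 ⟨i, hi⟩
    exact ⟨v, Fin.mk.inj_iff.1 hv⟩
  have hrq : r q = Fintype.card V(G) - 1 := by
    obtain ⟨v, hv⟩ := hsurj (Fintype.card V(G) - 1) (by omega)
    by_cases hvq : v = q
    · rw [← hvq, hv]
    · obtain ⟨u, -, hu⟩ := hq v hvq
      have h1 := (hrt v u).2 hu
      have h2 := hr u
      omega
  have hcut : ∀ i < Fintype.card V(G) - 1,
      IsCut G {v | i ≤ r v} {v | r v = i} {v | i < r v} := by
    intro i hi
    refine ⟨?_, ?_, ?_, ?_⟩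
    · ext v
      simp only [Set.mem_union, Set.mem_ofPred_eq]
      omega
    · rw [Set.disjoint_left]
      intro v hv hv'
      simp only [Set.mem_ofPred_eq] at hv hv'
      omega
    · obtain ⟨v, hv⟩ := hsurj i (by omega)
      have : {v | r v = i} = {v} := by
        ext w
        simp only [Set.mem_ofPred_eq, Set.mem_singleton_iff, ← hv]
        exact hinj.eq_iff
      rw [this]
      exact connectedSet_singleton v
    · have hqi : q ∈ {v | i < r v} := hi.trans_eq hrq.symm
      -- Following outgoing edges raises the rank, so the walk stays in the remainder until it
      -- reaches `q`.
      have key : ∀ d w (hw : i < r w), Fintype.card V(G) - r w ≤ d →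
          (G.toSimpleGraph.induce {v | i < r v}).Reachable ⟨q, hqi⟩ ⟨w, hw⟩ := by
        intro d
        induction d with
        | zero =>
          intro w hw hd
          have := hr w
          omega
        | succ d ih =>
          intro w hw hd
          by_cases hwq : w = q
          · subst hwq
            rfl
          · obtain ⟨u, hu, htu⟩ := hq w hwq
            have h1 := (hrt w u).2 htu
            refine (ih u (hw.trans h1) (by omega)).trans (SimpleGraph.Adj.reachable ?_)
            exact (adj_of_mult_pos G hu).symm
      refine (SimpleGraph.connected_iff_exists_forall_reachable _).2 ⟨⟨q, hqi⟩, ?_⟩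
      rintro ⟨w, hw⟩
      exact key _ w hw le_rfl
  -- Truncating ranks at `i` isolates the first `i` vertices and lumps the rest together.
  have hpart : ∀ i ≤ Fintype.card V(G) - 1,
      partitionAfter G (fun i => {v | r v = i}) (fun i => {v | i < r v}) i =
        levelSets G fun v => min (r v) i := by
    intro i
    induction i with
    | zero =>
      intro _
      ext S
      simp [levelSets, partitionAfter]
    | succ i ih =>
      intro hi
      rw [partitionAfter, ih (by omega), (hcut i (by omega)).union_eq]
      ext T
      constructor
      · rintro (rfl | rfl | ⟨⟨v, rfl⟩, hv⟩)
        · obtain ⟨v, hv⟩ := hsurj i (by omega)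
          refine ⟨v, ?_⟩
          ext w
          simp only [Set.mem_ofPred_eq]
          omega
        · refine ⟨q, ?_⟩
          ext w
          simp only [Set.mem_ofPred_eq]
          omega
        · have hvi : r v < i := by
            by_contra hvi
            apply hv
            rw [Set.mem_singleton_iff]
            ext w
            simp only [Set.mem_ofPred_eq]
            omega
          refine ⟨v, ?_⟩
          ext w
          simp only [Set.mem_ofPred_eq]
          omega
      · rintro ⟨v, rfl⟩
        rcases lt_trichotomy (r v) i with hvi | hvi | hvi
        · refine Or.inr (Or.inr ⟨⟨v, ?_⟩, fun he => ?_⟩)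
          · ext w
            simp only [Set.mem_ofPred_eq]
            omega
          · have : v ∈ {v | i ≤ r v} := (Set.mem_singleton_iff.1 he) ▸ rfl
            exact hvi.not_ge this
        · refine Or.inl ?_
          ext w
          simp only [Set.mem_ofPred_eq]
          omega
        · refine Or.inr (Or.inl ?_)
          ext w
          simp only [Set.mem_ofPred_eq]
          omega
  refine ⟨Fintype.card V(G) - 1, fun i => {v | r v = i}, fun i => {v | i < r v}, ⟨?_, ?_, ?_⟩,
    fun i => {v | i < r v}, fun i _ => Or.inr rfl, fun v => ?_⟩
  · intro h
    simpa using hcut 0 h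
  · intro i hi
    exact Or.inr (hcut (i + 1) hi)
  · rw [hpart _ le_rfl]
    refine (levelSets_eq_range_singleton_iff).2 fun v w h => hinj ?_
    have h1 := hr v
    have h2 := hr w
    have h3 : min (r v) (Fintype.card V(G) - 1) = min (r w) (Fintype.card V(G) - 1) := h
    omega
  · have hc : ∀ i ∈ Finset.range (Fintype.card V(G) - 1), ∀ _ : Decidable (v ∈ {v | i < r v}),
        (if v ∈ {v | i < r v} then (crossDeg G {v | r v = i} {v | i < r v} v : ℤ) else 0) =
        ∑ w, if r w = i ∧ i < r v then (mult G v w : ℤ) else 0 := by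
      intro i hi _
      by_cases hv : i < r v
      · rw [if_pos (show v ∈ {v | i < r v} from hv), crossDeg_comm,
          crossDeg_of_mem_left G (hcut i (Finset.mem_range.1 hi)).disjoint.symm hv]
        push_cast
        simp [hv]
      · simp [hv]
    refine Eq.trans ?_ (Finset.sum_congr rfl fun i hi => hc i hi _).symm
    rw [Finset.sum_comm, orderDivisor]
    refine Finset.sum_congr rfl fun w _ => ?_
    have hv := hr v
    by_cases hvw : t v < t w
    · have h1 := (hrt w v).2 hvw
      rw [if_pos hvw, Finset.sum_eq_single (r w)]
      · simp [h1]
      · intro i _ hi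
        simp [Ne.symm hi]
      · intro h
        rw [Finset.mem_range] at h
        omega
    · rw [if_neg hvw, eq_comm]
      refine Finset.sum_eq_zero fun i _ => if_neg ?_
      rintro ⟨h1, h2⟩
      exact hvw ((hrt w v).1 (h1 ▸ h2))

end GeneratingSequences

/-! ### The singleton partition and the theorem. -/

/-- The only partition of the vertices into as many connected components as there are vertices is
the partition into singletons. -/
theorem mem_connectedPartitions_card_iff [Fintype V(G)] {P : Set (Set V(G))} :
    P ∈ connectedPartitions G (Fintype.card V(G)) ↔ P = Set.range singleton := by
  constructor
  · rintro ⟨hP, hcard, -⟩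
    choose b hb using hP.2
    have hbP : ∀ v, b v ∈ P := fun v => (hb v).1.1
    have hbv : ∀ v, v ∈ b v := fun v => (hb v).1.2
    have hbu : ∀ v, ∀ S ∈ P, v ∈ S → S = b v := fun v S hS hv => (hb v).2 S ⟨hS, hv⟩
    -- The block map is onto a set with as many elements as `V`, hence injective.
    let f : V(G) → P := fun v => ⟨b v, hbP v⟩
    have hsurj : Function.Surjective f := by
      rintro ⟨S, hS⟩
      obtain ⟨v, hv⟩ : S.Nonempty := Set.nonempty_iff_ne_empty.2 fun h => hP.1 (h ▸ hS)
      exact ⟨v, Subtype.ext (hbu v S hS hv).symm⟩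
    have hinj : Function.Injective f := by
      refine (hsurj.bijective_of_nat_card_le ?_).1
      rw [Nat.card_coe_set_eq P, hcard, Nat.card_eq_fintype_card]
    have hbs : ∀ v, b v = {v} := by
      intro v
      refine Set.eq_singleton_iff_unique_mem.2 ⟨hbv v, fun w hw => ?_⟩
      exact hinj (Subtype.ext (hbu w _ (hbP v) hw).symm)
    ext S
    constructor
    · intro hS
      obtain ⟨v, hv⟩ := hsurj ⟨S, hS⟩
      exact ⟨v, (hbs v).symm.trans (Subtype.ext_iff.1 hv)⟩
    · rintro ⟨v, rfl⟩
      exact hbs v ▸ hbP v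
  · rintro rfl
    refine ⟨⟨?_, fun v => ⟨{v}, ⟨⟨v, rfl⟩, rfl⟩, ?_⟩⟩, ?_, ?_⟩
    · rintro ⟨v, hv⟩
      exact Set.singleton_ne_empty v hv
    · rintro _ ⟨⟨w, rfl⟩, hw⟩
      rw [Set.mem_singleton_iff.1 hw]
    · rw [← Nat.card_coe_set_eq, Nat.card_range_of_injective Set.singleton_injective,
        Nat.card_eq_fintype_card]
    · rintro _ ⟨v, rfl⟩
      exact connectedSet_singleton v

end ChipFiring

theorem proposition3p4 {α β : Type*} (G : Graph α β) [Fintype V(G)] [Finite E(G)] [G.Loopless]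
    (hconn : G.toSimpleGraph.Connected) (hn : 2 ≤ Fintype.card V(G)) :
    (∃! P, P ∈ ChipFiring.connectedPartitions G (Fintype.card V(G))) ∧
    ∀ P ∈ ChipFiring.connectedPartitions G (Fintype.card V(G)), ∀ D : V(G) → ℤ,
      ((∃ D', ChipFiring.Equivalent G D D' ∧ ChipFiring.IsBoundaryDivisor G P D') ↔
        ChipFiring.MinimallyAlive G D) ∧
      ((∃ D', ChipFiring.Equivalent G D D' ∧ ChipFiring.IsFreeBoundaryDivisor G P D') ↔
        ChipFiring.MinimallyAlive G D) := by
  refine ⟨⟨_, (ChipFiring.mem_connectedPartitions_card_iff G).2 rfl,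
    fun P hP => (ChipFiring.mem_connectedPartitions_card_iff G).1 hP⟩, fun P hP D => ?_⟩
  obtain rfl := (ChipFiring.mem_connectedPartitions_card_iff G).1 hP
  -- Up to equivalence, boundary implies free boundary, which implies minimally alive, which implies
  -- boundary; this cycle gives both equivalences.
  have hfree : ∀ D', ChipFiring.IsBoundaryDivisor G (Set.range singleton) D' →
      ChipFiring.IsFreeBoundaryDivisor G (Set.range singleton) D' :=
    fun D' ⟨k, A, B, h, hD⟩ => ⟨k, A, B, h.isFreeGeneratingSequence, hD⟩
  have halive : (∃ D', ChipFiring.Equivalent G D D' ∧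
      ChipFiring.IsFreeBoundaryDivisor G (Set.range singleton) D') →
      ChipFiring.MinimallyAlive G D := by
    rintro ⟨D', he, k, A, B, h, hD⟩
    obtain ⟨t, ht, rfl⟩ := h.exists_eq_orderDivisor hD hconn
    exact (ChipFiring.minimallyAlive_orderDivisor G hconn hn
      (ChipFiring.levelSets_eq_range_singleton_iff.1 ht)).congr he.symm
  have hboundary : ChipFiring.MinimallyAlive G D → ∃ D', ChipFiring.Equivalent G D D' ∧
      ChipFiring.IsBoundaryDivisor G (Set.range singleton) D' := by
    intro hD
    obtain ⟨t, ht, he⟩ := hD.exists_equivalent_orderDivisor G hconn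
    obtain ⟨q⟩ : Nonempty V(G) := hconn.nonempty
    obtain ⟨t', ht', he', hq⟩ :=
      ChipFiring.exists_equivalent_orderDivisor_unique_sink G hconn ht q
    exact ⟨_, he.trans he', ChipFiring.isBoundaryDivisor_orderDivisor hconn ht' hq⟩
  exact ⟨⟨fun ⟨D', he, h⟩ => halive ⟨D', he, hfree D' h⟩, hboundary⟩,
    ⟨halive, fun hD => (hboundary hD).imp fun D' h => ⟨h.1, hfree D' h.2⟩⟩⟩
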